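/- **Model.** Fix $J\ge 1$ items. A parameter is $\Xi=(\beta,a,d,\gamma)\in\mathbb R\times\mathbb R^J\times\mathbb R^J\times\mathbb R^J$. Individuals $i=1,2,\dots$ are i.i.d.; individual $i$ belongs to the reference group ($x_i=0$) or the focal group ($x_i=1$) with $P(x_i=1)=p\in(0,1)$, has a latent trait $\theta_i$ with $\theta_i\mid x_i\sim N(\beta x_i,1)$, and gives responses $Y_{i1},\dots,Y_{iJ}\in\{0,1\}$ that are conditionally independent given $(\theta_i,x_i)$ with $$P(Y_{ij}=1\mid\theta_i,x_i)=\frac{\exp(a_j\theta_i+d_j+\gamma_jx_i)}{1+\exp(a_j\theta_i+d_j+\gamma_jx_i)}.$$ Let $p_\Xi(y\mid x)=\int\prod_{j=1}^J\frac{\exp(y_j(a_j\theta+d_j+\gamma_jx))}{1+\exp(a_j\theta+d_j+\gamma_jx)}\,\frac{1}{\sqrt{2\pi}}e^{-(\theta-\beta x)^2/2}\,d\theta$ and let $L_N(\Xi)=\prod_{i=1}^N p_\Xi(Y_i\mid x_i)$ be the marginal likelihood. Only $(x_i,Y_i)$ enters the estimation. For $c\in\mathbb R$ put $T_c\Xi=(\beta+c,\,a,\,d,\,\gamma-ca)$;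 $T_c\Xi$ and $\Xi$ give the same $p_\Xi(\cdot\mid\cdot)$. **Assumptions.** The data are generated with true parameter $\Xi^*=(\beta^*,a^*,d^*,\gamma^*)$. Let $\Xi^\dagger=T_c\Xi^*$, for some $c\in\mathbb R$, be an equivalent parameter with $\gamma_1^\dagger=0$. Let $\Theta$ be the parameter space and $\Theta_1=\{\Xi\in\Theta:\gamma_1=0\}$. Suppose that 1. (identifiability of the normalised model) $\Xi^\dagger\in\Theta_1$, and if $\Xi\in\Theta_1$ satisfies $p_\Xi(y\mid x)=p_{\Xi^\dagger}(y\mid x)$ for all $y\in\{0,1\}^J$, $x\in\{0,1\}$, then $\Xi=\Xi^\dagger$; 2. (compactness) there is a compact set $K\subseteq\Theta$ such that the estimator $\tilde\Xi_N$ below lies in $K$ with probability tending to one (this is automatic with $K=\Theta$ if $\Theta$ is compact); 3. (minimal $L_1$ condition, ML1) $\sum_{j=1}^J|\gamma_j^*|<\sum_{j=1}^J|\gamma_j^*-a_j^*c|$ for all $c\ne0$. (Conditions 1 and 2 are what the conditions of Wald's consistency theorem, van der Vaart's *Asymptotic Statistics*, Theorem 5.14, amount to for this model; the remaining ones, upper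 semicontinuity and local domination of the log-likelihood, always hold here.) **Estimator.** Let $\tilde\Xi_N=(\tilde\beta,\tilde a,\tilde d,\tilde\gamma)$ be such that, with probability tending to one as $N\to\infty$, it maximises $\log L_N$ over $\Theta_1$. Let $\hat c$ be any minimiser of $c\mapsto\sum_{j=1}^J|\tilde\gamma_j-\tilde a_jc|$, and put $\hat\Xi_N=T_{\hat c}\tilde\Xi_N$, that is, $\hat\beta=\tilde\beta+\hat c$, $\hat\gamma_j=\tilde\gamma_j-\tilde a_j\hat c$, $\hat a_j=\tilde a_j$, $\hat d_j=\tilde d_j$. **Theorem.** Then, as $N\to\infty$, $|\hat\beta-\beta^*|=o_P(1)$ and, for every $j=1,\dots,J$, $|\hat\gamma_j-\gamma_j^*|=o_P(1)$, $|\hat a_j-a_j^*|=o_P(1)$ and $|\hat d_j-d_j^*|=o_P(1)$. -/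

import Mathlib

open MeasureTheory ProbabilityTheory Filter Topology

noncomputable section

namespace MIMIC

/-- A parameter vector `Ξ = (β, a, d, γ)` of the MIMIC model with `J` items, with the product
topology of `ℝ × ℝ^J × ℝ^J × ℝ^J`. -/
abbrev Param (J : ℕ) : Type := ℝ × (Fin J → ℝ) × (Fin J → ℝ) × (Fin J → ℝ)

/-- The structural parameter `β`. -/
def Param.beta {J : ℕ} (Ξ : Param J) : ℝ := Ξ.1

/-- The discrimination parameters `a_j`. -/
def Param.a {J : ℕ} (Ξ : Param J) : Fin J → ℝ := Ξ.2.1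

/-- The easiness parameters `d_j`. -/
def Param.d {J : ℕ} (Ξ : Param J) : Fin J → ℝ := Ξ.2.2.1

/-- The DIF parameters `γ_j`. -/
def Param.gamma {J : ℕ} (Ξ : Param J) : Fin J → ℝ := Ξ.2.2.2

/-- The transformation `β ↦ β + c`, `γ_j ↦ γ_j - a_j c`, keeping `a` and `d`. -/
def Param.shift {J : ℕ} (Ξ : Param J) (c : ℝ) : Param J :=
  (Ξ.beta + c, Ξ.a, Ξ.d, fun j => Ξ.gamma j - Ξ.a j * c)

/-- Two parameter vectors are equivalent when one is a shift of the other. -/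
def Param.Equivalent {J : ℕ} (Ξ Ξ' : Param J) : Prop := ∃ c : ℝ, Ξ' = Ξ.shift c

/-- The numerical value `0` or `1` of a group label or of a binary response. -/
def code (b : Fin 2) : ℝ := ((b : ℕ) : ℝ)

/-- The 2PL probability with DIF that item `j` is answered `b`, given group `g` and latent
trait `t`: `exp (b (a_j t + d_j + γ_j g)) / (1 + exp (a_j t + d_j + γ_j g))`. -/
def itemProb {J : ℕ} (Ξ : Param J) (g : Fin 2) (t : ℝ) (j : Fin J) (b : Fin 2) : ℝ :=
  Real.exp (code b * (Ξ.a j * t + Ξ.d j + Ξ.gamma j * code g)) /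
    (1 + Real.exp (Ξ.a j * t + Ξ.d j + Ξ.gamma j * code g))

/-- Local independence: the conditional probability of the response vector `y`, given group `g`
and latent trait `t`. -/
def responseProb {J : ℕ} (Ξ : Param J) (g : Fin 2) (t : ℝ) (y : Fin J → Fin 2) : ℝ :=
  ∏ j, itemProb Ξ g t j (y j)

/-- The conditional law `N(β g, 1)` of the latent trait in group `g`. -/
def traitLaw {J : ℕ} (Ξ : Param J) (g : Fin 2) : Measure ℝ :=
  gaussianReal (Ξ.beta * code g) 1

/-- The marginal likelihood of one response vector `y` in group `g`, the latent trait being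
integrated out. -/
def marginalProb {J : ℕ} (Ξ : Param J) (g : Fin 2) (y : Fin J → Fin 2) : ℝ :=
  ∫ t, responseProb Ξ g t y ∂(traitLaw Ξ g)

/-- The marginal likelihood `L(Ξ)` of the first `N` individuals, individual `i` being in group
`x i` with responses `y i`. -/
def likelihood {J : ℕ} (N : ℕ) (x : ℕ → Fin 2) (y : ℕ → Fin J → Fin 2) (Ξ : Param J) : ℝ :=
  ∏ i ∈ Finset.range N, marginalProb Ξ (x i) (y i)

/-- The probability of group `g` when an individual is in the focal group with probability `p`. -/
def groupProb (p : ℝ) (g : Fin 2) : ℝ := if g = 1 then p else 1 - p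

/-- `(x i, θ i, Y i)`, `i = 0, 1, 2, …`, is an i.i.d. sample of individuals from the MIMIC model
with parameter `Ξ`, focal group probability `p`, groups `x i`, latent traits `θ i` and response
vectors `Y i`. The field `law` is the hierarchical description of the joint law of one individual:
the group is drawn with probability `groupProb p`, the trait given group `g` from `N(β g, 1)`, and
the responses given both from `responseProb`. -/
structure IsSample {Ω : Type*} [MeasurableSpace Ω] (μ : Measure Ω) {J : ℕ} (p : ℝ) (Ξ : Param J)
    (x : ℕ → Ω → Fin 2) (θ : ℕ → Ω → ℝ) (Y : ℕ → Ω → Fin J → Fin 2) : Prop where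
  measurable_x : ∀ i, Measurable (x i)
  measurable_theta : ∀ i, Measurable (θ i)
  measurable_Y : ∀ i, Measurable (Y i)
  indep : iIndepFun (fun i ω => (x i ω, θ i ω, Y i ω)) μ
  law : ∀ (i : ℕ) (g : Fin 2) (B : Set ℝ) (y : Fin J → Fin 2), MeasurableSet B →
    μ.real {ω | x i ω = g ∧ θ i ω ∈ B ∧ Y i ω = y} =
      groupProb p g * ∫ t in B, responseProb Ξ g t y ∂(traitLaw Ξ g)

/-- The parameters in the parameter space `Θ` that satisfy the constraint that the DIF parameter
of the first item vanishes. -/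
def normalised {J : ℕ} [NeZero J] (Θ : Set (Param J)) : Set (Param J) :=
  {Ξ | Ξ ∈ Θ ∧ Ξ.gamma 0 = 0}

/-- Within the set `S` of parameters, only `Ξ₀` gives the conditional distributions of the response
vector, given the group, that `Ξ₀` gives. -/
def IdentifiableAt {J : ℕ} (S : Set (Param J)) (Ξ₀ : Param J) : Prop :=
  Ξ₀ ∈ S ∧ ∀ Ξ ∈ S, (∀ g y, marginalProb Ξ g y = marginalProb Ξ₀ g y) → Ξ = Ξ₀

/-- The minimal `L₁` condition. -/
def ML1 {J : ℕ} (Ξ : Param J) : Prop :=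
  ∀ c : ℝ, c ≠ 0 → ∑ j, |Ξ.gamma j| < ∑ j, |Ξ.gamma j - Ξ.a j * c|

/-- Step 1 of the algorithm: `Ξt` maximises the marginal log-likelihood of the first `N`
individuals over the parameters in `Θ` with vanishing first DIF parameter. -/
def IsStep1 {J : ℕ} [NeZero J] (Θ : Set (Param J)) (N : ℕ) (x : ℕ → Fin 2)
    (y : ℕ → Fin J → Fin 2) (Ξt : Param J) : Prop :=
  Ξt ∈ normalised Θ ∧ IsMaxOn (fun Ξ => Real.log (likelihood N x y Ξ)) (normalised Θ) Ξt

/-- Step 2 of the algorithm: `c` minimises the least absolute deviations objective. -/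
def IsStep2 {J : ℕ} (Ξt : Param J) (c : ℝ) : Prop :=
  ∀ c' : ℝ, ∑ j, |Ξt.gamma j - Ξt.a j * c| ≤ ∑ j, |Ξt.gamma j - Ξt.a j * c'|

/-- The events `E N` have (inner) probability tending to one as `N → ∞`. -/
def WithProbTendingToOne {Ω : Type*} [MeasurableSpace Ω] (μ : Measure Ω) (E : ℕ → Ω → Prop) :
    Prop :=
  Tendsto (fun N => μ {ω | ¬ E N ω}) atTop (𝓝 0)

end MIMIC

end

namespace MIMIC

variable {J : ℕ}

/-! ### Events of probability tending to one -/

section WithProb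

variable {Ω : Type*} [MeasurableSpace Ω] {μ : Measure Ω} {E F : ℕ → Ω → Prop}

/-! One observation (group, responses) takes finitely many values, each of positive probability. The
log-likelihood ratio of `Ξ` against the normalised truth, divided by `N`, is therefore a finite sum,
linear in the empirical frequencies and jointly continuous in frequencies and `Ξ`
(`weightedLogRatio`). No uniform law of large numbers is needed. At the true cell probabilities the
sum is strictly negative unless `Ξ` gives the same marginals (Gibbs). By identifiability and
compactness it stays negative on `K` outside a neighbourhood of the normalised truth for all nearby
weights, and the frequencies become such weights. A maximiser has a nonnegative ratio, so it lies in
that neighbourhood.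

For Step 2, ML1 says that the objective at the normalised truth has a unique minimiser, the shift
leading back to the true parameter. Convexity in the scalar `c` makes minimisers stable under
perturbation (`eventually_isStep2_dist_lt`), and the shift is continuous.

Only outer measures of bad events are bounded, so the estimators need not be measurable. -/

lemma WithProbTendingToOne.mono (hE : WithProbTendingToOne μ E) (h : ∀ N ω, E N ω → F N ω) :
    WithProbTendingToOne μ F :=
  tendsto_of_tendsto_of_tendsto_of_le_of_le tendsto_const_nhds hE (fun _ => zero_le)
    fun N => measure_mono fun ω hω hEω => hω (h N ω hEω)

lemma WithProbTendingToOne.and (hE : WithProbTendingToOne μ E) (hF : WithProbTendingToOne μ F) :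
    WithProbTendingToOne μ fun N ω => E N ω ∧ F N ω := by
  have hsum := Tendsto.add hE hF
  rw [add_zero] at hsum
  refine tendsto_of_tendsto_of_tendsto_of_le_of_le tendsto_const_nhds hsum (fun _ => zero_le)
    fun N => (measure_mono fun ω hω => ?_).trans (measure_union_le _ _)
  exact not_and_or.mp hω

/-- If `Z N` lies in every neighbourhood of `z` with probability tending to one and `f` is
continuous at `z`, then `f (Z N)` converges to `f z` in probability. -/
lemma tendstoInMeasure_of_withProb {X : Type*} [TopologicalSpace X] {Z : ℕ → Ω → X} {z : X}
    (hZ : ∀ U ∈ 𝓝 z, WithProbTendingToOne μ fun N ω => Z N ω ∈ U) {f : X → ℝ}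
    (hf : ContinuousAt f z) :
    TendstoInMeasure μ (fun N ω => f (Z N ω)) atTop (fun _ => f z) := by
  intro ε hε
  have hU : f ⁻¹' Metric.eball (f z) ε ∈ 𝓝 z := hf (Metric.eball_mem_nhds _ hε)
  refine (hZ _ hU).congr fun N => ?_
  congr 1
  ext ω
  simp [Metric.mem_eball]

/-- Coordinatewise convergence in probability to a constant vector with finitely many entries. -/
lemma withProb_of_tendstoInMeasure_pi {ι : Type*} [Fintype ι] {Z : ℕ → Ω → ι → ℝ} {z : ι → ℝ}
    (h : ∀ k, TendstoInMeasure μ (fun N ω => Z N ω k) atTop (fun _ => z k))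
    {U : Set (ι → ℝ)} (hU : U ∈ 𝓝 z) : WithProbTendingToOne μ fun N ω => Z N ω ∈ U := by
  obtain ⟨ε, hε, hball⟩ := Metric.mem_nhds_iff.mp hU
  have hsum : Tendsto (fun N => ∑ k, μ {ω | ε ≤ dist (Z N ω k) (z k)}) atTop (𝓝 0) := by
    simpa using tendsto_finsetSum Finset.univ
      fun k _ => tendstoInMeasure_iff_dist.mp (h k) ε hε
  refine tendsto_of_tendsto_of_tendsto_of_le_of_le tendsto_const_nhds hsum (fun _ => zero_le)
    fun N => (measure_mono fun ω hω => ?_).trans (measure_iUnion_fintype_le μ _)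
  by_contra hcon
  simp only [Set.mem_iUnion, Set.mem_ofPred_eq, not_exists, not_le] at hcon
  exact hω (hball ((dist_pi_lt_iff hε).mpr hcon))

end WithProb

/-! ### The marginal response probabilities -/

lemma itemProb_pos (Ξ : Param J) (g : Fin 2) (t : ℝ) (j : Fin J) (b : Fin 2) :
    0 < itemProb Ξ g t j b := by
  unfold itemProb; positivity

lemma itemProb_sum (Ξ : Param J) (g : Fin 2) (t : ℝ) (j : Fin J) :
    ∑ b, itemProb Ξ g t j b = 1 := by
  have h : 1 + Real.exp (Ξ.a j * t + Ξ.d j + Ξ.gamma j * code g) ≠ 0 := by positivity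
  simp only [itemProb, Fin.sum_univ_two, code, Fin.val_zero, Fin.val_one]
  simp only [Nat.cast_zero, Nat.cast_one, zero_mul, one_mul, Real.exp_zero]
  rw [← add_div]
  exact div_self h

lemma responseProb_pos (Ξ : Param J) (g : Fin 2) (t : ℝ) (y : Fin J → Fin 2) :
    0 < responseProb Ξ g t y :=
  Finset.prod_pos fun j _ => itemProb_pos Ξ g t j (y j)

lemma responseProb_sum (Ξ : Param J) (g : Fin 2) (t : ℝ) : ∑ y, responseProb Ξ g t y = 1 := by
  have h := Finset.prod_univ_sum (fun _ : Fin J => (Finset.univ : Finset (Fin 2)))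
    (fun j b => itemProb Ξ g t j b)
  simp only [itemProb_sum, Finset.prod_const_one, Fintype.piFinset_univ] at h
  exact h.symm

lemma responseProb_le_one (Ξ : Param J) (g : Fin 2) (t : ℝ) (y : Fin J → Fin 2) :
    responseProb Ξ g t y ≤ 1 := by
  rw [← responseProb_sum Ξ g t]
  exact Finset.single_le_sum (f := responseProb Ξ g t)
    (fun y _ => (responseProb_pos Ξ g t y).le) (Finset.mem_univ y)

lemma norm_responseProb_le_one (Ξ : Param J) (g : Fin 2) (t : ℝ) (y : Fin J → Fin 2) :
    ‖responseProb Ξ g t y‖ ≤ 1 := by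
  rw [Real.norm_of_nonneg (responseProb_pos Ξ g t y).le]
  exact responseProb_le_one Ξ g t y

lemma continuous_responseProb (g : Fin 2) (y : Fin J → Fin 2) :
    Continuous fun z : Param J × ℝ => responseProb z.1 g z.2 y := by
  unfold responseProb itemProb Param.a Param.d Param.gamma
  refine continuous_finsetProd _ fun j _ => Continuous.div (by fun_prop) (by fun_prop)
    fun z => by positivity

lemma integrable_responseProb (Ξ : Param J) (g : Fin 2) (y : Fin J → Fin 2) (ν : Measure ℝ)
    [IsFiniteMeasure ν] : Integrable (fun t => responseProb Ξ g t y) ν :=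
  Integrable.of_bound
    ((continuous_responseProb g y).comp (by fun_prop : Continuous fun t : ℝ => (Ξ, t))
      ).aestronglyMeasurable 1 (ae_of_all _ fun t => norm_responseProb_le_one Ξ g t y)

instance (Ξ : Param J) (g : Fin 2) : IsProbabilityMeasure (traitLaw Ξ g) := by
  unfold traitLaw; infer_instance

lemma marginalProb_pos (Ξ : Param J) (g : Fin 2) (y : Fin J → Fin 2) :
    0 < marginalProb Ξ g y := by
  unfold marginalProb
  rw [integral_pos_iff_support_of_nonneg (fun t => (responseProb_pos Ξ g t y).le)
    (integrable_responseProb Ξ g y _)]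
  have : Function.support (fun t => responseProb Ξ g t y) = Set.univ :=
    Set.eq_univ_of_forall fun t => (responseProb_pos Ξ g t y).ne'
  rw [this, measure_univ]
  exact one_pos

lemma marginalProb_sum (Ξ : Param J) (g : Fin 2) : ∑ y, marginalProb Ξ g y = 1 := by
  unfold marginalProb
  rw [← integral_finsetSum _ fun y _ => integrable_responseProb Ξ g y _]
  simp [responseProb_sum]

/-- The marginal probabilities as integrals against the standard normal distribution. -/
lemma marginalProb_eq_integral_standard (Ξ : Param J) (g : Fin 2) (y : Fin J → Fin 2) :
    marginalProb Ξ g y =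
      ∫ t, responseProb Ξ g (t + Ξ.beta * code g) y ∂(gaussianReal 0 1) := by
  have hmap : traitLaw Ξ g = (gaussianReal 0 1).map (fun t => t + Ξ.beta * code g) := by
    rw [gaussianReal_map_add_const, zero_add]; rfl
  unfold marginalProb
  rw [hmap, integral_map (by fun_prop)]
  exact ((continuous_responseProb g y).comp
    (by fun_prop : Continuous fun t : ℝ => (Ξ, t))).aestronglyMeasurable

lemma continuous_responseProb_add_beta (g : Fin 2) (y : Fin J → Fin 2) :
    Continuous fun v : Param J × ℝ => responseProb v.1 g (v.2 + v.1.beta * code g) y := by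
  have hbeta : Continuous fun v : Param J × ℝ => v.1.beta := continuous_fst.comp continuous_fst
  exact (continuous_responseProb g y).comp
    (continuous_fst.prodMk (continuous_snd.add (hbeta.mul continuous_const)))

/-- Writing the trait as a standard normal plus its mean moves `β` into the integrand; the measure
is then fixed and dominated convergence applies with bound 1. -/
lemma continuous_marginalProb (g : Fin 2) (y : Fin J → Fin 2) :
    Continuous fun Ξ : Param J => marginalProb Ξ g y := by
  simp only [marginalProb_eq_integral_standard]
  refine continuous_of_dominated (bound := fun _ => 1) (fun Ξ => ?_)
    (fun Ξ => ae_of_all _ fun t => norm_responseProb_le_one Ξ g _ y) (integrable_const _)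
    (ae_of_all _ fun t => ?_)
  · exact ((continuous_responseProb_add_beta g y).comp
      (continuous_const.prodMk continuous_id)).aestronglyMeasurable
  · have hpair : Continuous fun Ξ : Param J => (Ξ, t) := continuous_id.prodMk continuous_const
    have h := (continuous_responseProb_add_beta g y).comp hpair
    simpa only [Function.comp_def] using h

/-- Moving the focal trait mean by `c` adds `a_j c` to each focal linear predictor, which the change
in `γ_j` cancels. -/
lemma marginalProb_shift (Ξ : Param J) (c : ℝ) (g : Fin 2) (y : Fin J → Fin 2) :
    marginalProb (Ξ.shift c) g y = marginalProb Ξ g y := by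
  simp only [marginalProb_eq_integral_standard]
  congr 1
  ext t
  unfold responseProb itemProb
  refine Finset.prod_congr rfl fun j _ => ?_
  have h : (Ξ.shift c).a j * (t + (Ξ.shift c).beta * code g) + (Ξ.shift c).d j +
      (Ξ.shift c).gamma j * code g =
      Ξ.a j * (t + Ξ.beta * code g) + Ξ.d j + Ξ.gamma j * code g := by
    simp only [Param.shift, Param.a, Param.d, Param.gamma, Param.beta]
    ring
  rw [h]

/-! ### Consistency of the normalised maximum likelihood estimator -/

/-- The log-likelihood ratio of `Ξ` and `Ξ₀`, averaged with weights `w` over the possible values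
of the group and the response vector of one individual. -/
noncomputable def weightedLogRatio (w : Fin 2 × (Fin J → Fin 2) → ℝ) (Ξ₀ Ξ : Param J) : ℝ :=
  ∑ z, w z * (Real.log (marginalProb Ξ z.1 z.2) - Real.log (marginalProb Ξ₀ z.1 z.2))

lemma continuous_weightedLogRatio (Ξ₀ : Param J) :
    Continuous fun v : (Fin 2 × (Fin J → Fin 2) → ℝ) × Param J =>
      weightedLogRatio v.1 Ξ₀ v.2 := by
  unfold weightedLogRatio
  refine continuous_finsetSum _ fun z _ => Continuous.mul (by fun_prop)
    (Continuous.sub (Continuous.log ?_ fun v => (marginalProb_pos _ _ _).ne') continuous_const)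
  exact (continuous_marginalProb z.1 z.2).comp continuous_snd

/-- The probabilities of the values of the group and the response vector. -/
noncomputable def cellProb (p : ℝ) (Ξ : Param J) (z : Fin 2 × (Fin J → Fin 2)) : ℝ :=
  groupProb p z.1 * marginalProb Ξ z.1 z.2

/-- The strict Gibbs inequality for the model. -/
lemma weightedLogRatio_cellProb_neg {p : ℝ} (hp0 : 0 < p) (hp1 : p < 1) {Ξ₀ Ξ : Param J}
    (hne : ∃ g y, marginalProb Ξ g y ≠ marginalProb Ξ₀ g y) :
    weightedLogRatio (cellProb p Ξ₀) Ξ₀ Ξ < 0 := by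
  have hgroup : ∀ g, 0 < groupProb p g := fun g => by
    unfold groupProb; split_ifs <;> linarith
  have hzero : ∑ z : Fin 2 × (Fin J → Fin 2),
      groupProb p z.1 * (marginalProb Ξ z.1 z.2 - marginalProb Ξ₀ z.1 z.2) = 0 := by
    rw [Fintype.sum_prod_type]
    simp only [← Finset.mul_sum, Finset.sum_sub_distrib, marginalProb_sum, sub_self, mul_zero,
      Finset.sum_const_zero]
  have hterm : ∀ z : Fin 2 × (Fin J → Fin 2),
      cellProb p Ξ₀ z *
          (Real.log (marginalProb Ξ z.1 z.2) - Real.log (marginalProb Ξ₀ z.1 z.2)) =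
        groupProb p z.1 * (marginalProb Ξ₀ z.1 z.2 *
          Real.log (marginalProb Ξ z.1 z.2 / marginalProb Ξ₀ z.1 z.2)) := fun z => by
    rw [Real.log_div (marginalProb_pos _ _ _).ne' (marginalProb_pos _ _ _).ne', cellProb]
    ring
  have hdiff : ∀ z : Fin 2 × (Fin J → Fin 2),
      marginalProb Ξ z.1 z.2 - marginalProb Ξ₀ z.1 z.2 = marginalProb Ξ₀ z.1 z.2 *
        (marginalProb Ξ z.1 z.2 / marginalProb Ξ₀ z.1 z.2 - 1) := fun z => by
    have := (marginalProb_pos Ξ₀ z.1 z.2).ne'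
    field_simp
  -- Replacing 0 by this vanishing sum reduces the claim to `log r ≤ r - 1` term by term, strict
  -- where the marginals differ.
  rw [← hzero]
  refine Finset.sum_lt_sum (fun z _ => ?_) ?_
  · rw [hterm, hdiff]
    exact mul_le_mul_of_nonneg_left (mul_le_mul_of_nonneg_left
      (Real.log_le_sub_one_of_pos (div_pos (marginalProb_pos _ _ _) (marginalProb_pos _ _ _)))
      (marginalProb_pos _ _ _).le) (hgroup _).le
  · obtain ⟨g, y, h⟩ := hne
    refine ⟨(g, y), Finset.mem_univ _, ?_⟩
    rw [hterm, hdiff]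
    refine mul_lt_mul_of_pos_left (mul_lt_mul_of_pos_left
      (Real.log_lt_sub_one_of_pos (div_pos (marginalProb_pos _ _ _) (marginalProb_pos _ _ _))
        fun h1 => h ?_) (marginalProb_pos _ _ _)) (hgroup _)
    exact (div_eq_one_iff_eq (marginalProb_pos _ _ _).ne').mp h1

/-- The observed relative frequencies of the values of the group and the response vector. -/
noncomputable def empiricalFreq (N : ℕ) (x : ℕ → Fin 2) (y : ℕ → Fin J → Fin 2)
    (z : Fin 2 × (Fin J → Fin 2)) : ℝ :=
  (∑ i ∈ Finset.range N, if (x i, y i) = z then (1 : ℝ) else 0) / N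

/-- Individuals are grouped by their observed cell. For `N = 0` both sides are 0, since division by
zero gives 0. -/
lemma weightedLogRatio_empiricalFreq (N : ℕ) (x : ℕ → Fin 2) (y : ℕ → Fin J → Fin 2)
    (Ξ₀ Ξ : Param J) :
    weightedLogRatio (empiricalFreq N x y) Ξ₀ Ξ =
      (Real.log (likelihood N x y Ξ) - Real.log (likelihood N x y Ξ₀)) / N := by
  unfold likelihood weightedLogRatio empiricalFreq
  rw [Real.log_prod fun i _ => (marginalProb_pos _ _ _).ne',
    Real.log_prod fun i _ => (marginalProb_pos _ _ _).ne', ← Finset.sum_sub_distrib]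
  simp only [div_mul_eq_mul_div, ← Finset.sum_div, Finset.sum_mul]
  rw [Finset.sum_comm]
  congr 1
  refine Finset.sum_congr rfl fun i _ => ?_
  simp

lemma IsStep1.weightedLogRatio_nonneg [NeZero J] {Θ : Set (Param J)} {N : ℕ} {x : ℕ → Fin 2}
    {y : ℕ → Fin J → Fin 2} {Ξ₀ Ξ : Param J} (h : IsStep1 Θ N x y Ξ)
    (h₀ : Ξ₀ ∈ normalised Θ) : 0 ≤ weightedLogRatio (empiricalFreq N x y) Ξ₀ Ξ := by
  rw [weightedLogRatio_empiricalFreq]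
  exact div_nonneg (sub_nonneg.mpr (h.2 h₀)) N.cast_nonneg

/-- Outside a neighbourhood of an identifiable parameter, the averaged log-likelihood ratio is
negative for all weights close to the cell probabilities, uniformly on compact sets. -/
lemma eventually_weightedLogRatio_neg [NeZero J] {p : ℝ} (hp0 : 0 < p) (hp1 : p < 1)
    {Θ K U : Set (Param J)} {Ξ₀ : Param J} (hident : IdentifiableAt (normalised Θ) Ξ₀)
    (hKΘ : K ⊆ Θ) (hK : IsCompact K) (hU : U ∈ 𝓝 Ξ₀) :
    ∀ᶠ w in 𝓝 (cellProb p Ξ₀), ∀ Ξ ∈ K, Ξ.gamma 0 = 0 → Ξ ∉ U →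
      weightedLogRatio w Ξ₀ Ξ < 0 := by
  obtain ⟨V, hVU, hV, hmem⟩ := mem_nhds_iff.mp hU
  have hclosed : IsClosed ({Ξ : Param J | Ξ.gamma 0 = 0} ∩ Vᶜ) := by
    refine IsClosed.inter (isClosed_eq ?_ continuous_const) hV.isClosed_compl
    unfold Param.gamma
    fun_prop
  have hcomp := hK.inter_right hclosed
  -- Tube lemma: pointwise negativity at the true weights, with joint continuity, gives one
  -- neighbourhood of weights for the whole compact set.
  have hev := hcomp.eventually_forall_of_forall_eventually (x₀ := cellProb p Ξ₀)
    (P := fun w Ξ => weightedLogRatio w Ξ₀ Ξ < 0) fun Ξ hΞ => by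
      refine (continuous_weightedLogRatio Ξ₀).continuousAt.eventually_lt continuousAt_const ?_
      refine weightedLogRatio_cellProb_neg hp0 hp1 ?_
      by_contra! hcon
      have := hident.2 Ξ ⟨hKΘ hΞ.1, hΞ.2.1⟩ hcon
      exact hΞ.2.2 (this ▸ hmem)
  filter_upwards [hev] with w hw Ξ hΞK hΞ0 hΞU
  exact hw Ξ ⟨hΞK, hΞ0, fun h => hΞU (hVU h)⟩

section Sample

variable {Ω : Type*} [MeasurableSpace Ω] {μ : Measure Ω} {p : ℝ} {Ξ : Param J}
  {x : ℕ → Ω → Fin 2} {θ : ℕ → Ω → ℝ} {Y : ℕ → Ω → Fin J → Fin 2}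

lemma IsSample.measureReal_cell (h : IsSample μ p Ξ x θ Y) (i : ℕ)
    (z : Fin 2 × (Fin J → Fin 2)) : μ.real {ω | (x i ω, Y i ω) = z} = cellProb p Ξ z := by
  have := h.law i z.1 Set.univ z.2 MeasurableSet.univ
  simp only [Set.mem_univ, true_and, setIntegral_univ] at this
  simpa [Prod.ext_iff, cellProb, marginalProb] using this

/-- The strong law of large numbers for the observed relative frequencies. -/
lemma IsSample.tendstoInMeasure_empiricalFreq [IsProbabilityMeasure μ]
    (h : IsSample μ p Ξ x θ Y) (z : Fin 2 × (Fin J → Fin 2)) :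
    TendstoInMeasure μ
      (fun N ω => empiricalFreq N (fun i => x i ω) (fun i => Y i ω) z) atTop
      (fun _ => cellProb p Ξ z) := by
  have hpair : ∀ i, Measurable fun ω => (x i ω, Y i ω) :=
    fun i => (h.measurable_x i).prodMk (h.measurable_Y i)
  have hind : Measurable fun v : Fin 2 × (Fin J → Fin 2) => if v = z then (1 : ℝ) else 0 :=
    measurable_of_countable _
  have hmeas : ∀ i, Measurable fun ω => if (x i ω, Y i ω) = z then (1 : ℝ) else 0 :=
    fun i => hind.comp (hpair i)
  have hint : ∀ i, Integrable (fun ω => if (x i ω, Y i ω) = z then (1 : ℝ) else 0) μ :=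
    fun i => Integrable.of_bound (hmeas i).aestronglyMeasurable 1
      (ae_of_all _ fun ω => by split_ifs <;> simp)
  have hindep : Pairwise (Function.onFun (fun f g => IndepFun f g μ)
      fun i ω => if (x i ω, Y i ω) = z then (1 : ℝ) else 0) := fun i j hij =>
    (h.indep.indepFun hij).comp
      (φ := fun v : Fin 2 × ℝ × (Fin J → Fin 2) => if (v.1, v.2.2) = z then (1 : ℝ) else 0)
      (ψ := fun v : Fin 2 × ℝ × (Fin J → Fin 2) => if (v.1, v.2.2) = z then (1 : ℝ) else 0)
      (hind.comp (by fun_prop)) (hind.comp (by fun_prop))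
  -- Identical distribution is not a field of `IsSample`; it follows from `law`, as the observable
  -- pair is discrete and atoms suffice.
  have hident : ∀ i, IdentDistrib (fun ω => (x i ω, Y i ω)) (fun ω => (x 0 ω, Y 0 ω)) μ μ :=
    fun i => by
      refine ⟨(hpair i).aemeasurable, (hpair 0).aemeasurable, Measure.ext_of_singleton fun v => ?_⟩
      rw [Measure.map_apply (hpair i) (measurableSet_singleton v),
        Measure.map_apply (hpair 0) (measurableSet_singleton v)]
      exact (measureReal_eq_measureReal_iff).mp
        ((h.measureReal_cell i v).trans (h.measureReal_cell 0 v).symm)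
  have hmean : μ[fun ω => if (x 0 ω, Y 0 ω) = z then (1 : ℝ) else 0] = cellProb p Ξ z := by
    rw [← h.measureReal_cell 0 z]
    have hset : MeasurableSet {ω | (x 0 ω, Y 0 ω) = z} := hpair 0 (measurableSet_singleton z)
    rw [← integral_indicator_one hset]
    congr 1
    ext ω
    simp [Set.indicator_apply]
  have hslln := strong_law_ae_real
    (fun i ω => if (x i ω, Y i ω) = z then (1 : ℝ) else 0) (hint 0) hindep
    fun i => (hident i).comp hind
  rw [hmean] at hslln
  refine tendstoInMeasure_of_tendsto_ae (fun N => ?_) hslln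
  exact ((Finset.measurable_sum _ fun i _ => hmeas i).div_const _).aestronglyMeasurable

/-- Wald consistency of the maximum likelihood estimator in the normalised model. -/
lemma withProb_maximiser_mem_nhds [NeZero J] [IsProbabilityMeasure μ]
    (hsample : IsSample μ p Ξ x θ Y) (hp0 : 0 < p) (hp1 : p < 1) {Ξ₀ : Param J}
    (hequiv : Ξ.Equivalent Ξ₀) {Θ K : Set (Param J)}
    (hident : IdentifiableAt (normalised Θ) Ξ₀) {Ξt : ℕ → Ω → Param J}
    (hstep1 : WithProbTendingToOne μ fun N ω =>
      IsStep1 Θ N (fun i => x i ω) (fun i => Y i ω) (Ξt N ω))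
    (hKΘ : K ⊆ Θ) (hK : IsCompact K) (hmem : WithProbTendingToOne μ fun N ω => Ξt N ω ∈ K)
    (U : Set (Param J)) (hU : U ∈ 𝓝 Ξ₀) : WithProbTendingToOne μ fun N ω => Ξt N ω ∈ U := by
  have hcell : cellProb p Ξ = cellProb p Ξ₀ := by
    obtain ⟨c, rfl⟩ := hequiv
    ext z
    simp only [cellProb, marginalProb_shift]
  have hfreq := withProb_of_tendstoInMeasure_pi
    (fun z => hcell ▸ hsample.tendstoInMeasure_empiricalFreq z)
    (eventually_weightedLogRatio_neg hp0 hp1 hident hKΘ hK hU)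
  refine ((hfreq.and hstep1).and hmem).mono fun N ω hω => ?_
  by_contra hnot
  exact absurd (hω.1.2.weightedLogRatio_nonneg hident.1)
    (not_le.mpr (hω.1.1 _ hω.2 hω.1.2.1.2 hnot))

end Sample

/-! ### The least absolute deviations step -/

lemma continuous_ladObjective :
    Continuous fun v : Param J × ℝ => ∑ j, |v.1.gamma j - v.1.a j * v.2| := by
  unfold Param.gamma Param.a
  fun_prop

lemma convexOn_ladObjective (Ξ : Param J) :
    ConvexOn ℝ Set.univ fun c : ℝ => ∑ j, |Ξ.gamma j - Ξ.a j * c| := by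
  refine ⟨convex_univ, fun c _ c' _ s t hs ht hst => ?_⟩
  simp only [smul_eq_mul, Finset.mul_sum, ← Finset.sum_add_distrib]
  refine Finset.sum_le_sum fun j _ => ?_
  have hsplit : Ξ.gamma j - Ξ.a j * (s * c + t * c') =
      s * (Ξ.gamma j - Ξ.a j * c) + t * (Ξ.gamma j - Ξ.a j * c') := by
    linear_combination (-Ξ.gamma j) * hst
  rw [hsplit]
  refine (abs_add_le _ _).trans_eq ?_
  rw [abs_mul, abs_mul, abs_of_nonneg hs, abs_of_nonneg ht]

/-- Minimisers of the least absolute deviations objective are stable at a parameter at which the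
minimiser is unique. -/
lemma eventually_isStep2_dist_lt {Ξ₀ : Param J} {c₀ : ℝ}
    (hmin : ∀ c ≠ c₀, ∑ j, |Ξ₀.gamma j - Ξ₀.a j * c₀| < ∑ j, |Ξ₀.gamma j - Ξ₀.a j * c|)
    {ε : ℝ} (hε : 0 < ε) : ∀ᶠ Ξ in 𝓝 Ξ₀, ∀ c, IsStep2 Ξ c → dist c c₀ < ε := by
  have hcont : ∀ c : ℝ, Continuous fun Ξ : Param J => ∑ j, |Ξ.gamma j - Ξ.a j * c| :=
    fun c => continuous_ladObjective.comp (by fun_prop : Continuous fun Ξ : Param J => (Ξ, c))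
  -- Only the three points `c₀` and `c₀ ± ε` are compared: these strict inequalities persist near
  -- `Ξ₀`, and convexity handles all other `c`.
  have hright := (hcont c₀).continuousAt.eventually_lt (hcont (c₀ + ε)).continuousAt
    (hmin (c₀ + ε) (by linarith))
  have hleft := (hcont c₀).continuousAt.eventually_lt (hcont (c₀ - ε)).continuousAt
    (hmin (c₀ - ε) (by linarith))
  filter_upwards [hright, hleft] with Ξ hr hl c hc
  have hconv := convexOn_ladObjective Ξ
  rw [Real.dist_eq, abs_lt]
  constructor <;> by_contra! hcon
  -- If a minimiser `c` lay beyond `c₀ - ε`, convexity would bound the value at `c₀ - ε` by the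
  -- larger endpoint value, the one at `c₀`.
  · have := hconv.le_max_of_mem_Icc (Set.mem_univ c) (Set.mem_univ c₀)
      (⟨by linarith, by linarith⟩ : c₀ - ε ∈ Set.Icc c c₀)
    rw [max_eq_right (hc c₀)] at this
    exact absurd hl (not_lt.mpr this)
  · have := hconv.le_max_of_mem_Icc (Set.mem_univ c₀) (Set.mem_univ c)
      (⟨by linarith, by linarith⟩ : c₀ + ε ∈ Set.Icc c₀ c)
    rw [max_eq_left (hc c₀)] at this
    exact absurd hr (not_lt.mpr this)

lemma continuous_shift : Continuous fun v : Param J × ℝ => v.1.shift v.2 := by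
  unfold Param.shift Param.beta Param.a Param.d Param.gamma
  fun_prop

lemma shift_shift_neg (Ξ : Param J) (c : ℝ) : (Ξ.shift c).shift (-c) = Ξ := by
  simp [Param.shift, Param.beta, Param.a, Param.d, Param.gamma]

/-- Under the minimal `L₁` condition the output of Step 2 depends continuously on its input at
every parameter equivalent to the true one. -/
lemma ML1.eventually_shift_mem {Ξ Ξ₀ : Param J} (hML1 : ML1 Ξ) (hequiv : Ξ.Equivalent Ξ₀)
    {U : Set (Param J)} (hU : U ∈ 𝓝 Ξ) :
    ∀ᶠ Ξt in 𝓝 Ξ₀, ∀ c, IsStep2 Ξt c → Ξt.shift c ∈ U := by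
  obtain ⟨c₀, rfl⟩ := hequiv
  -- The residuals of `Ξ.shift c₀` at `c` are those of `Ξ` at `c + c₀`, so ML1 becomes uniqueness of
  -- the minimiser `-c₀`.
  have hmin : ∀ c ≠ -c₀, ∑ j, |(Ξ.shift c₀).gamma j - (Ξ.shift c₀).a j * -c₀| <
      ∑ j, |(Ξ.shift c₀).gamma j - (Ξ.shift c₀).a j * c| := fun c hc => by
    have h := hML1 (c + c₀) fun h => hc (by linarith)
    refine lt_of_eq_of_lt ?_ (h.trans_eq ?_) <;> refine Finset.sum_congr rfl fun j _ => ?_ <;>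
      congr 1 <;> simp only [Param.shift, Param.a, Param.gamma] <;> ring
  have hpre : ∀ᶠ v : Param J × ℝ in 𝓝 (Ξ.shift c₀) ×ˢ 𝓝 (-c₀), v.1.shift v.2 ∈ U := by
    rw [← nhds_prod_eq]
    refine continuous_shift.continuousAt ?_
    rw [shift_shift_neg]
    exact hU
  obtain ⟨P, hP, Q, hQ, hPQ⟩ := Filter.eventually_prod_iff.mp hpre
  obtain ⟨ε, hε, hball⟩ := Metric.eventually_nhds_iff.mp hQ
  filter_upwards [hP, eventually_isStep2_dist_lt hmin hε] with Ξt hΞt hdist c hc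
  exact hPQ hΞt (hball (hdist c hc))

end MIMIC


theorem theorem1 {Ω : Type*} [MeasurableSpace Ω] (μ : Measure Ω) [IsProbabilityMeasure μ]
    (J : ℕ) [NeZero J]
    -- the true parameters and the equivalent parameters with vanishing first DIF parameter
    (Ξstar Ξdag : MIMIC.Param J) (hequiv : Ξstar.Equivalent Ξdag)
    -- i.i.d. observations from the model with the true parameters, both groups being present
    (p : ℝ) (hp0 : 0 < p) (hp1 : p < 1)
    (x : ℕ → Ω → Fin 2) (θ : ℕ → Ω → ℝ) (Y : ℕ → Ω → Fin J → Fin 2)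
    (hsample : MIMIC.IsSample μ p Ξstar x θ Y)
    -- the parameter space, in which the normalised model is identifiable
    (Θ : Set (MIMIC.Param J))
    (hident : MIMIC.IdentifiableAt (MIMIC.normalised Θ) Ξdag)
    -- the minimal L₁ condition
    (hML1 : MIMIC.ML1 Ξstar)
    -- Step 1 and Step 2 of the algorithm
    (Ξtilde : ℕ → Ω → MIMIC.Param J) (chat : ℕ → Ω → ℝ)
    (hstep1 : MIMIC.WithProbTendingToOne μ fun N ω =>
      MIMIC.IsStep1 Θ N (fun i => x i ω) (fun i => Y i ω) (Ξtilde N ω))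
    (hstep2 : ∀ N ω, MIMIC.IsStep2 (Ξtilde N ω) (chat N ω))
    -- Wald's compactness requirement (automatic for a compact parameter space)
    (hcompact : ∃ K : Set (MIMIC.Param J), K ⊆ Θ ∧ IsCompact K ∧
      MIMIC.WithProbTendingToOne μ fun N ω => Ξtilde N ω ∈ K)
    -- the output of the algorithm
    (Ξhat : ℕ → Ω → MIMIC.Param J)
    (houtput : ∀ N ω, Ξhat N ω = (Ξtilde N ω).shift (chat N ω)) :
    TendstoInMeasure μ (fun N ω => (Ξhat N ω).beta) atTop (fun _ => Ξstar.beta) ∧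
    (∀ j, TendstoInMeasure μ (fun N ω => (Ξhat N ω).gamma j) atTop (fun _ => Ξstar.gamma j)) ∧
    (∀ j, TendstoInMeasure μ (fun N ω => (Ξhat N ω).a j) atTop (fun _ => Ξstar.a j)) ∧
    (∀ j, TendstoInMeasure μ (fun N ω => (Ξhat N ω).d j) atTop (fun _ => Ξstar.d j)) := by
  obtain ⟨K, hKΘ, hK, hmem⟩ := hcompact
  have hhat : ∀ U ∈ 𝓝 Ξstar, MIMIC.WithProbTendingToOne μ fun N ω => Ξhat N ω ∈ U := by
    intro U hU
    refine (MIMIC.withProb_maximiser_mem_nhds hsample hp0 hp1 hequiv hident hstep1 hKΘ hK hmem _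
      (hML1.eventually_shift_mem hequiv hU)).mono fun N ω hω => ?_
    rw [houtput]
    exact hω _ (hstep2 N ω)
  have hconv (f : MIMIC.Param J → ℝ) (hf : Continuous f) :
      TendstoInMeasure μ (fun N ω => f (Ξhat N ω)) atTop (fun _ => f Ξstar) :=
    MIMIC.tendstoInMeasure_of_withProb hhat hf.continuousAt
  refine ⟨hconv (fun Ξ => Ξ.beta) ?_, fun j => hconv (fun Ξ => Ξ.gamma j) ?_,
    fun j => hconv (fun Ξ => Ξ.a j) ?_, fun j => hconv (fun Ξ => Ξ.d j) ?_⟩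
  · exact continuous_fst
  · exact (continuous_apply j).comp (continuous_snd.comp (continuous_snd.comp continuous_snd))
  · exact (continuous_apply j).comp (continuous_fst.comp continuous_snd)
  · exact (continuous_apply j).comp (continuous_fst.comp (continuous_snd.comp continuous_snd))
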